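/- Let $k$ be a field, let $X$ be a smooth projective geometrically connected $k$-surface and let $f\colon X\to\mathbb{P}^1_k$ be a $k$-morphism whose generic fibre is a smooth (geometrically connected) curve of genus $0$ (a conic bundle). Assume that $f$ is relatively minimal: every birational morphism over $\mathbb{P}^1_k$ from $X$ to a smooth projective geometrically connected $k$-surface $Y\to\mathbb{P}^1_k$ is an isomorphism. A closed point of the base is said to be a point of bad reduction of a fibration if the fibre over it is not smooth over its residue field. Let $M\in\mathbb{P}^1_k$ be a closed point at which $f$ has bad reduction, let $K=k(M)$ be its residue field, let $f_K\colon X_K\to\mathbb{P}^1_K$ be the base change of $f$ from $k$ to $K$, and let $N$ be a $K$-rational point of $\mathbb{P}^1_K$ lying above $M$. Then $f_K$ has bad reduction at $N$. Moreover the bad fibre is the same one: the projections $\mathbb{P}^1_K\to\mathbb{P}^1_k$ and $X_K\to X$ induce an isomorphism of residue fields $k(M)\cong k(N)$ and, compatibly with it, an isomorphism of fibres $(X_K)_N\cong X_M$. -/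

import Mathlib

universe u

open CategoryTheory Limits AlgebraicGeometry

noncomputable section

attribute [local instance] MvPolynomial.gradedAlgebra

/-- Projective `n`-space over a commutative ring `k`: `Proj k[x₀, …, xₙ]`. -/
def ProjSpace (n : ℕ) (k : Type u) [CommRing k] : Scheme.{u} :=
  Proj (MvPolynomial.homogeneousSubmodule (Fin (n + 1)) k)

/-- The structure morphism `ℙⁿ_k ⟶ Spec k`. -/
def ProjSpace.toSpec (n : ℕ) (k : Type u) [CommRing k] :
    ProjSpace n k ⟶ Spec (CommRingCat.of k) :=
  Proj.toSpecZero (MvPolynomial.homogeneousSubmodule (Fin (n + 1)) k) ≫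
    Spec.map (CommRingCat.ofHom
      (algebraMap k (MvPolynomial.homogeneousSubmodule (Fin (n + 1)) k 0)))

/-- `s : X ⟶ Spec k` is projective: `X` is a closed `k`-subscheme of some `ℙⁿ_k`. -/
def IsProjectiveOver (k : Type u) [CommRing k] {X : Scheme.{u}}
    (s : X ⟶ Spec (CommRingCat.of k)) : Prop :=
  ∃ (n : ℕ) (i : X ⟶ ProjSpace n k), IsClosedImmersion i ∧ i ≫ ProjSpace.toSpec n k = s

/-- `s : X ⟶ Spec k` is a smooth projective geometrically connected `k`-surface. -/
structure IsSmoothProjectiveSurface (k : Type u) [Field k] {X : Scheme.{u}}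
    (s : X ⟶ Spec (CommRingCat.of k)) : Prop where
  projective : IsProjectiveOver k s
  smooth : SmoothOfRelativeDimension 2 s
  geometricallyConnected : GeometricallyConnected s

/-- The structure sheaf of a scheme, as a sheaf of abelian groups. -/
def structureSheafAb (C : Scheme.{u}) :
    Sheaf (Opens.grothendieckTopology C) AddCommGrpCat.{u} :=
  (sheafCompose _ (forget₂ CommRingCat.{u} RingCat.{u} ⋙ forget₂ RingCat.{u} AddCommGrpCat.{u})).obj
    C.sheaf

/-- `p : C ⟶ S` (with `S` the spectrum of a field) is a smooth proper geometrically connected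
curve of genus zero, i.e. with `H¹(C, 𝒪_C) = 0`. -/
structure IsSmoothGenusZeroCurve {C S : Scheme.{u}} (p : C ⟶ S) : Prop where
  proper : IsProper p
  smooth : SmoothOfRelativeDimension 1 p
  geometricallyConnected : GeometricallyConnected p
  genus_eq_zero : Subsingleton ((structureSheafAb C).H 1)

/-- A morphism is birational if it is an isomorphism over a dense open of the target whose
preimage is dense. -/
def IsBirationalMorphism {X Y : Scheme.{u}} (σ : X ⟶ Y) : Prop :=
  ∃ V : Y.Opens, Dense (V : Set Y) ∧ Dense ((σ ⁻¹ᵁ V : X.Opens) : Set X) ∧ IsIso (σ ∣_ V)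

/-- `f : X ⟶ ℙ¹_k` is a conic bundle: `X`, with its structure of `k`-scheme induced by `f`, is a
smooth projective geometrically connected surface and the generic fibre of `f` is a smooth curve
of genus zero. -/
structure IsConicBundle (k : Type u) [Field k] {X : Scheme.{u}} (f : X ⟶ ProjSpace 1 k) :
    Prop where
  surface : IsSmoothProjectiveSurface k (f ≫ ProjSpace.toSpec 1 k)
  genericFibre : ∃ η : ProjSpace 1 k, IsGenericPoint η Set.univ ∧
    IsSmoothGenusZeroCurve (f.fiberToSpecResidueField η)

/-- `f : X ⟶ ℙ¹_k` is relatively minimal: every birational morphism over `ℙ¹_k` from `X` to a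
smooth projective geometrically connected `k`-surface is an isomorphism. -/
def IsRelativelyMinimal (k : Type u) [Field k] {X : Scheme.{u}} (f : X ⟶ ProjSpace 1 k) : Prop :=
  ∀ (Y : Scheme.{u}) (g : Y ⟶ ProjSpace 1 k) (σ : X ⟶ Y),
    IsSmoothProjectiveSurface k (g ≫ ProjSpace.toSpec 1 k) → σ ≫ g = f →
    IsBirationalMorphism σ → IsIso σ

/-- `M` is a point of bad reduction of `f`: a closed point whose fibre is not smooth over the
residue field of `M`. -/
def HasBadReductionAt {X B : Scheme.{u}} (f : X ⟶ B) (M : B) : Prop :=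
  IsClosed {M} ∧ ¬ Smooth (f.fiberToSpecResidueField M)

/-- The base change `Z_T` of a morphism `s : Z ⟶ S` along `t : T ⟶ S`. -/
abbrev BaseChange {Z S T : Scheme.{u}} (s : Z ⟶ S) (t : T ⟶ S) : Scheme.{u} := pullback s t

/-- The base change `f_T : X_T ⟶ Z_T` of an `S`-morphism `f : X ⟶ Z` along `t : T ⟶ S`. -/
abbrev baseChangeHom {X Z S T : Scheme.{u}} (f : X ⟶ Z) (s : Z ⟶ S) (t : T ⟶ S) :
    BaseChange (f ≫ s) t ⟶ BaseChange s t :=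
  pullback.map (f ≫ s) t s t f (𝟙 T) (𝟙 S) (by simp) (by simp)

/-- The morphism `Spec k(M) ⟶ Spec k` of a point `M` of `ℙ¹_k`. -/
abbrev residueSpecToSpec (k : Type u) [Field k] (M : ProjSpace 1 k) :
    Spec ((ProjSpace 1 k).residueField M) ⟶ Spec (CommRingCat.of k) :=
  (ProjSpace 1 k).fromSpecResidueField M ≫ ProjSpace.toSpec 1 k

/-- A point `N` of an `S`-scheme `Z` (`S` the spectrum of a field `K`) is `K`-rational if its
residue field is `K`. -/
def IsRationalPoint {Z S : Scheme.{u}} (s : Z ⟶ S) (N : Z) : Prop :=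
  IsIso (Z.fromSpecResidueField N ≫ s)

end

/-!
A `k(M)`-rational point `N` above `M` gives two embeddings of `k(M)` in `k(N)`: the isomorphism
expressing rationality, and the map induced by the projection back to the original base. They agree
up to an endomorphism of `k(M)` over the ground field, which need not be the identity but is
bijective because `k(M)` is algebraic over the ground field. So the projection induces an
isomorphism of residue fields and hence, as fibres are compatible with base change, an isomorphism
of fibres.
-/

lemma isIso_of_comp_eq_of_locallyOfFiniteType_of_field {k K : Type u} [Field k] [Field K]
    {p : Spec (.of K) ⟶ Spec (.of k)} [LocallyOfFiniteType p]
    {g : Spec (.of K) ⟶ Spec (.of K)} (hg : g ≫ p = p) : IsIso g := by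
  obtain ⟨φ, rfl⟩ := Spec.map_surjective p
  obtain ⟨γ, rfl⟩ := Spec.map_surjective g
  rw [← Spec.map_comp] at hg
  have hγ : φ ≫ γ = φ := Spec.map_injective hg
  algebraize [φ.hom]
  have : Module.Finite k K := (IsFinite.SpecMap_iff φ).mp
    (isFinite_iff_locallyOfFiniteType_of_jacobsonSpace.mpr ‹_›)
  let γₐ : K →ₐ[k] K := { γ.hom with commutes' := fun r ↦ congr($hγ r) }
  have : IsIso γ := (ConcreteCategory.isIso_iff_bijective γ).mpr
    (Algebra.IsAlgebraic.algHom_bijective γₐ)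
  infer_instance

lemma isIso_of_comp_eq_of_locallyOfFiniteType {K : Type u} [Field K] {S : Scheme.{u}}
    {p : Spec (.of K) ⟶ S} [LocallyOfFiniteType p]
    {g : Spec (.of K) ⟶ Spec (.of K)} (hg : g ≫ p = p) : IsIso g := by
  obtain ⟨x, φ, rfl⟩ : ∃ (x : S) (φ : S.residueField x ⟶ .of K),
      Spec.map φ ≫ S.fromSpecResidueField x = p :=
    ⟨_, _, Scheme.descResidueField_stalkClosedPointTo_fromSpecResidueField K S p⟩
  have : LocallyOfFiniteType (Spec.map φ) :=
    locallyOfFiniteType_of_comp _ (S.fromSpecResidueField x)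
  have hgφ : g ≫ Spec.map φ = Spec.map φ := by
    rw [← cancel_mono (S.fromSpecResidueField x), Category.assoc, hg]
  exact isIso_of_comp_eq_of_locallyOfFiniteType_of_field (k := S.residueField x) hgφ

section InducedMaps

/-- The morphism `Spec k(N) ⟶ Spec k(M)` induced by a morphism `q` with `q N = M`. The equality is
kept as a hypothesis, so that `M` may be a prescribed point. -/
noncomputable def specResidueFieldMap {W Z : Scheme.{u}} (q : W ⟶ Z) {N : W} {M : Z}
    (h : q N = M) : Spec (W.residueField N) ⟶ Spec (Z.residueField M) :=
  Spec.map (q.residueFieldMap N) ≫ Spec.map (Z.residueFieldCongr h.symm).hom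

lemma specResidueFieldMap_fromSpecResidueField {W Z : Scheme.{u}} (q : W ⟶ Z) {N : W} {M : Z}
    (h : q N = M) :
    specResidueFieldMap q h ≫ Z.fromSpecResidueField M = W.fromSpecResidueField N ≫ q := by
  simp [specResidueFieldMap]

variable {X' X W Z : Scheme.{u}} {q' : X' ⟶ X} {f' : X' ⟶ W} {f : X ⟶ Z} {q : W ⟶ Z}
  {N : W} {M : Z}

/-- The morphism from the fibre of `f'` at `N` to the fibre of `f` at `M` induced by a commutative
square from `f'` to `f` whose bottom side `q` maps `N` to `M`. -/
noncomputable def fiberMap (sq : CommSq q' f' f q) (h : q N = M) : f'.fiber N ⟶ f.fiber M :=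
  pullback.map f' (W.fromSpecResidueField N) f (Z.fromSpecResidueField M) q'
    (specResidueFieldMap q h) q sq.w.symm (specResidueFieldMap_fromSpecResidueField q h).symm

lemma fiberMap_fiberι (sq : CommSq q' f' f q) (h : q N = M) :
    fiberMap sq h ≫ f.fiberι M = f'.fiberι N ≫ q' :=
  pullback.lift_fst _ _ _

lemma fiberMap_fiberToSpecResidueField (sq : CommSq q' f' f q) (h : q N = M) :
    fiberMap sq h ≫ f.fiberToSpecResidueField M =
      f'.fiberToSpecResidueField N ≫ specResidueFieldMap q h :=
  pullback.lift_snd _ _ _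

lemma isPullback_fiberMap (sq : IsPullback q' f' f q) (h : q N = M) :
    IsPullback (fiberMap sq.toCommSq h) (f'.fiberToSpecResidueField N)
      (f.fiberToSpecResidueField M) (specResidueFieldMap q h) := by
  subst h
  simpa [fiberMap, specResidueFieldMap] using!
    isPullback_fiberToSpecResidueField_of_isPullback sq N

lemma isIso_fiberMap (sq : IsPullback q' f' f q) (h : q N = M) [IsIso (specResidueFieldMap q h)] :
    IsIso (fiberMap sq.toCommSq h) :=
  (isPullback_fiberMap sq h).isIso_fst_of_isIso

lemma fiberToSpecResidueField_iff_of_isPullback (P : MorphismProperty Scheme.{u}) [P.RespectsIso]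
    (sq : IsPullback q' f' f q) (h : q N = M) [IsIso (specResidueFieldMap q h)] :
    P (f'.fiberToSpecResidueField N) ↔ P (f.fiberToSpecResidueField M) := by
  have := isIso_fiberMap sq h
  rw [← P.cancel_right_of_respectsIso _ (specResidueFieldMap q h),
    ← fiberMap_fiberToSpecResidueField sq.toCommSq h, P.cancel_left_of_respectsIso]

end InducedMaps

lemma IsRationalPoint.isClosed_singleton {Z S : Scheme.{u}} [JacobsonSpace Z] {s : Z ⟶ S} {N : Z}
    (hN : IsRationalPoint s N) : IsClosed {N} := by
  have : IsIso (Z.fromSpecResidueField N ≫ s) := hN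
  exact isClosed_singleton_iff_locallyOfFiniteType.mpr (locallyOfFiniteType_of_comp _ s)

lemma IsRationalPoint.isIso_specResidueFieldMap {W Z S : Scheme.{u}} {s : Z ⟶ S} {q : W ⟶ Z}
    {N : W} {M : Z} {r : W ⟶ Spec (Z.residueField M)} (hN : IsRationalPoint r N)
    [LocallyOfFiniteType (Z.fromSpecResidueField M ≫ s)]
    (w : q ≫ s = r ≫ Z.fromSpecResidueField M ≫ s) (h : q N = M) :
    IsIso (specResidueFieldMap q h) := by
  let ρ := W.fromSpecResidueField N ≫ r
  have : IsIso ρ := hN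
  have hover : (inv ρ ≫ specResidueFieldMap q h) ≫ Z.fromSpecResidueField M ≫ s =
      Z.fromSpecResidueField M ≫ s := by
    rw [Category.assoc, reassoc_of% specResidueFieldMap_fromSpecResidueField q h, w,
      IsIso.inv_comp_eq, Category.assoc]
  have : IsIso (inv ρ ≫ specResidueFieldMap q h) :=
    isIso_of_comp_eq_of_locallyOfFiniteType (K := Z.residueField M) hover
  exact IsIso.of_isIso_comp_left (inv ρ) _

lemma isPullback_baseChangeHom {X Z S T : Scheme.{u}} (f : X ⟶ Z) (s : Z ⟶ S) (t : T ⟶ S) :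
    IsPullback (pullback.fst (f ≫ s) t) (baseChangeHom f s t) f (pullback.fst s t) := by
  refine .of_bot (h₃₁ := t) (v₂₁ := pullback.snd s t) (v₂₂ := s) ?_
    (pullback.lift_fst _ _ _).symm (.of_hasPullback _ _)
  rw [pullback.lift_snd, Category.comp_id]
  exact .of_hasPullback _ _

section ProjSpace

attribute [local instance] MvPolynomial.gradedAlgebra

lemma algebraMap_homogeneousSubmodule_zero_surjective (σ R : Type*) [CommRing R] :
    Function.Surjective (algebraMap R (MvPolynomial.homogeneousSubmodule σ R 0)) := by
  rintro ⟨p, hp⟩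
  rw [MvPolynomial.homogeneousSubmodule_zero, Submodule.mem_one] at hp
  obtain ⟨r, rfl⟩ := hp
  exact ⟨r, rfl⟩

instance ProjSpace.locallyOfFiniteType_toSpec (n : ℕ) (k : Type u) [CommRing k] :
    LocallyOfFiniteType (ProjSpace.toSpec n k) := by
  let 𝒜 := MvPolynomial.homogeneousSubmodule (Fin (n + 1)) k
  have : IsScalarTower k (𝒜 0) (MvPolynomial (Fin (n + 1)) k) :=
    ⟨fun a x y ↦ smul_mul_assoc a x.1 y⟩
  have : Algebra.FiniteType (𝒜 0) (MvPolynomial (Fin (n + 1)) k) :=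
    .of_restrictScalars_finiteType k _ _
  have : IsClosedImmersion (Spec.map (CommRingCat.ofHom (algebraMap k (𝒜 0)))) :=
    .spec_of_surjective _ (algebraMap_homogeneousSubmodule_zero_surjective (Fin (n + 1)) k)
  exact locallyOfFiniteType_comp (Proj.toSpecZero 𝒜) _

end ProjSpace

theorem mainTheorem9_general {X Z S : Scheme.{u}} (f : X ⟶ Z) (s : Z ⟶ S) [LocallyOfFiniteType s]
    (M : Z) (hM : HasBadReductionAt f M)
    (N : ↥(BaseChange s (Z.fromSpecResidueField M ≫ s)))
    (hNrat : IsRationalPoint (pullback.snd s (Z.fromSpecResidueField M ≫ s)) N)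
    (hNM : pullback.fst s (Z.fromSpecResidueField M ≫ s) N = M) :
    HasBadReductionAt (baseChangeHom f s (Z.fromSpecResidueField M ≫ s)) N ∧
    ∃ (e : (baseChangeHom f s (Z.fromSpecResidueField M ≫ s)).fiber N ≅ f.fiber M)
      (ε : Spec (Scheme.residueField _ N) ≅ Spec (Z.residueField M)),
      e.hom ≫ f.fiberι M =
        (baseChangeHom f s (Z.fromSpecResidueField M ≫ s)).fiberι N ≫
          pullback.fst (f ≫ s) (Z.fromSpecResidueField M ≫ s) ∧
      ε.hom ≫ Z.fromSpecResidueField M =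
        Scheme.fromSpecResidueField _ N ≫ pullback.fst s (Z.fromSpecResidueField M ≫ s) ∧
      e.hom ≫ f.fiberToSpecResidueField M =
        (baseChangeHom f s (Z.fromSpecResidueField M ≫ s)).fiberToSpecResidueField N ≫ ε.hom := by
  obtain ⟨hMclosed, hMsmooth⟩ := hM
  have : LocallyOfFiniteType (Z.fromSpecResidueField M) :=
    have := isClosed_singleton_iff_isClosedImmersion.mp hMclosed
    inferInstance
  have : JacobsonSpace ↥(BaseChange s (Z.fromSpecResidueField M ≫ s)) :=
    LocallyOfFiniteType.jacobsonSpace (pullback.snd s (Z.fromSpecResidueField M ≫ s))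
  have : IsIso (specResidueFieldMap _ hNM) :=
    hNrat.isIso_specResidueFieldMap pullback.condition hNM
  have sq := isPullback_baseChangeHom f s (Z.fromSpecResidueField M ≫ s)
  have : IsIso (fiberMap sq.toCommSq hNM) := isIso_fiberMap sq hNM
  have : MorphismProperty.RespectsIso (C := Scheme.{u}) @Smooth :=
    MorphismProperty.IsStableUnderBaseChange.respectsIso
  refine ⟨⟨hNrat.isClosed_singleton, ?_⟩, asIso (fiberMap sq.toCommSq hNM),
    asIso (specResidueFieldMap _ hNM), fiberMap_fiberι sq.toCommSq hNM,
    specResidueFieldMap_fromSpecResidueField _ hNM,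
    fiberMap_fiberToSpecResidueField sq.toCommSq hNM⟩
  exact (fiberToSpecResidueField_iff_of_isPullback @Smooth sq hNM).not.mpr hMsmooth

/-- With `K = k(M)`, `f_K : X_K ⟶ ℙ¹_K` the base change of `f`, and `N` a `K`-point of `ℙ¹_K`
above `M`: the fibration `f_K` has bad reduction at `N`. The last part says that `k(N)/k(M)` is
trivial and that the fibre of `f_K` at `N` is carried isomorphically to that of `f` at `M` by the
projection, so that both fibres become reducible over the same extension. -/
theorem mainTheorem9 (k : Type u) [Field k] (X : Scheme.{u}) (f : X ⟶ ProjSpace 1 k)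
    (hf : IsConicBundle k f) (hmin : IsRelativelyMinimal k f)
    (M : ProjSpace 1 k) (hM : HasBadReductionAt f M)
    (N : ↥(BaseChange (ProjSpace.toSpec 1 k) (residueSpecToSpec k M)))
    (hNrat : IsRationalPoint (pullback.snd (ProjSpace.toSpec 1 k) (residueSpecToSpec k M)) N)
    (hNM : pullback.fst (ProjSpace.toSpec 1 k) (residueSpecToSpec k M) N = M) :
    HasBadReductionAt
      (baseChangeHom f (ProjSpace.toSpec 1 k) (residueSpecToSpec k M)) N ∧
    ∃ (e : (baseChangeHom f (ProjSpace.toSpec 1 k) (residueSpecToSpec k M)).fiber N ≅ f.fiber M)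
      (ε : Spec (Scheme.residueField _ N) ≅ Spec (Scheme.residueField _ M)),
      e.hom ≫ f.fiberι M =
        (baseChangeHom f (ProjSpace.toSpec 1 k) (residueSpecToSpec k M)).fiberι N ≫
          pullback.fst (f ≫ ProjSpace.toSpec 1 k) (residueSpecToSpec k M) ∧
      ε.hom ≫ (ProjSpace 1 k).fromSpecResidueField M =
        Scheme.fromSpecResidueField _ N ≫
          pullback.fst (ProjSpace.toSpec 1 k) (residueSpecToSpec k M) ∧
      e.hom ≫ f.fiberToSpecResidueField M =
        (baseChangeHom f (ProjSpace.toSpec 1 k) (residueSpecToSpec k M)).fiberToSpecResidueField N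
          ≫ ε.hom :=
  mainTheorem9_general f (ProjSpace.toSpec 1 k) M hM N hNrat hNM
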